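/- **Setting.** A multicast game consists of a finite connected undirected graph $G=(V,E)$, a root $t\in V$, edge costs $c_e\ge 0$ (real), and a set $S\subseteq V\setminus\{t\}$ of activated vertices (the players). Each player $i\in S$ chooses a path $P_i$ in $G$ from $i$ to $t$; the outcome $\mathbf P=(P_i)_{i\in S}$ costs $c(\mathbf P)=\sum_{e\in\bigcup_i P_i}c_e$. The ordered cost-sharing protocol of a total order $\pi$ of $V$ charges the full cost $c_e$ of every used edge $e$ to that one of the players using $e$ who comes first in $\pi$. A Nash equilibrium is an outcome in which no player can lower the sum of her charges by changing only her own path. The price of anarchy (PoA) of the protocol on $G$ with root $t$ is the maximum, over all $S\subseteq V\setminus\{t\}$ and all Nash equilibria $\mathbf P$ of the game for $S$, of $c(\mathbf P)/\min_{\mathbf P'}c(\mathbf P')$, where $\mathbf P'$ runs over all outcomes for $S$ (with $0/0=0$ and $a/0=\infty$ for $a>0$). A graph is outerplanar if it can be drawn with its vertices at distinct points of a circle and its edges as straight chords that do not cross. It is biconnected if it has at least three vertices, is connected, and remains connected after the deletion of any single vertex. **Theorem.** Let $G$ be a connected outerplanar graph on a vertex set $V$ with $3\le|V|<\infty$, with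 edge costs $c_e\ge 0$ and root $t\in V$. Then there is a biconnected outerplanar graph $H$ on $V$ that contains $G$ as a subgraph ($H=G$ is possible if $G$ is biconnected). Moreover, every such $H$ has a Hamiltonian cycle, and its edge set is unique. Let $\Xi_{tour}$ be the ordered protocol whose order is that in which the vertices appear along this cycle, starting from $t$ (in either of the two directions). Then, in the game on $G$, for every $S\subseteq V\setminus\{t\}$ there is a Nash equilibrium under $\Xi_{tour}$, and the PoA of $\Xi_{tour}$ on $G$ with root $t$ is at most $8$. That is, for every $S\subseteq V\setminus\{t\}$ every Nash equilibrium of the game for $S$ costs at most $8$ times the minimum cost of an outcome for $S$. -/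

import Mathlib

open scoped NNReal ENNReal

namespace Multicast

variable {V : Type*}

/-- `G` is outerplanar: it has a plane drawing in a closed disk with all vertices on the boundary
circle (hence on the outer face), the edges being straight chords. Two chords with a common endpoint
meet in that endpoint only, so it suffices to ask that edges without a common endpoint be disjoint. -/
def IsOuterplanar (G : SimpleGraph V) : Prop :=
  ∃ p : V → Circle, Function.Injective p ∧
    ∀ a b x y : V, G.Adj a b → G.Adj x y → a ≠ x → a ≠ y → b ≠ x → b ≠ y →
      Disjoint (segment ℝ (p a : ℂ) (p b : ℂ)) (segment ℝ (p x : ℂ) (p y : ℂ))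

/-- `G` is biconnected: it has at least three vertices, is connected, and stays connected when any
one vertex is deleted. -/
structure IsBiconnected [Fintype V] (G : SimpleGraph V) : Prop where
  three_le_card : 3 ≤ Fintype.card V
  connected : G.Connected
  connected_delete : ∀ v : V, (G.induce {v}ᶜ).Connected

/-- A cost-sharing protocol: `ξ e i R` is the share of the edge `e` that the player at vertex `i`
pays when `R` is the set of players using `e`. It does not depend on the activated set. -/
abbrev Protocol (V : Type*) := Sym2 V → V → Finset V → ℝ≥0

variable [DecidableEq V]

/-- The ordered protocol for edge costs `c` and an (injective) labelling `π` of the vertices: the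
full cost of an edge is paid by that one of its users who comes first in the order. -/
def orderedProtocol (c : Sym2 V → ℝ≥0) (π : V → ℕ) : Protocol V :=
  fun e i R => if i ∈ R ∧ ∀ j ∈ R, π i ≤ π j then c e else 0

/-- The position of a vertex on a closed tour from `t`; the root has position `0`. -/
def tourPosition {H : SimpleGraph V} {t : V} (p : H.Walk t t) (v : V) : ℕ :=
  p.support.idxOf v

/-- The protocol that orders the vertices as they appear on the tour `p` from the root `t`. -/
def tourProtocol (c : Sym2 V → ℝ≥0) {H : SimpleGraph V} {t : V} (p : H.Walk t t) : Protocol V :=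
  orderedProtocol c (tourPosition p)

section Game

variable (G : SimpleGraph V) (t : V) (S : Finset V)

/-- An outcome: every player, i.e. every activated vertex, chooses a path in `G` to the root. -/
abbrev Outcome := (i : S) → G.Path (i : V) t

variable {G t S}

/-- The edges of a path. -/
def pathEdges {u v : V} (P : G.Path u v) : Finset (Sym2 V) := P.1.edges.toFinset

/-- The set of players using the edge `e` in the outcome `P`. -/
def users (P : Outcome G t S) (e : Sym2 V) : Finset V :=
  (Finset.univ.filter fun i : S => e ∈ pathEdges (P i)).map (Function.Embedding.subtype _)

/-- The cost share of player `i` in the outcome `P`. -/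
def playerCost (ξ : Protocol V) (P : Outcome G t S) (i : S) : ℝ≥0 :=
  ∑ e ∈ pathEdges (P i), ξ e i (users P e)

/-- The cost of an outcome: the total cost of the union of the chosen paths. -/
def outcomeCost (c : Sym2 V → ℝ≥0) (P : Outcome G t S) : ℝ≥0 :=
  ∑ e ∈ Finset.univ.biUnion (fun i : S => pathEdges (P i)), c e

/-- `P` is a pure Nash equilibrium: no player has a cheaper path, the others' paths being fixed. -/
def IsNash (ξ : Protocol V) (P : Outcome G t S) : Prop :=
  ∀ (i : S) (Q : G.Path (i : V) t), playerCost ξ P i ≤ playerCost ξ (Function.update P i Q) i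

variable (G t S)

/-- The minimum cost of an outcome (that is, of a Steiner tree for `S ∪ {t}`). -/
noncomputable def optCost (c : Sym2 V → ℝ≥0) : ℝ≥0∞ :=
  ⨅ P : Outcome G t S, (outcomeCost c P : ℝ≥0∞)

/-- The price of anarchy of `ξ` on `G` with root `t`: the worst ratio, over all activated sets and all
Nash equilibria, of the cost of the equilibrium to the optimal cost. In `ℝ≥0∞` one has `0 / 0 = 0`,
and `a / 0 = ∞` for `a ≠ 0`. -/
noncomputable def priceOfAnarchy (c : Sym2 V → ℝ≥0) (ξ : Protocol V) : ℝ≥0∞ :=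
  ⨆ (S : Finset V) (_ : t ∉ S) (P : Outcome G t S) (_ : IsNash ξ P),
    (outcomeCost c P : ℝ≥0∞) / optCost G t S c

end Game

end Multicast

/-!
Whether two chords of a circle cross depends only on the circular order of their ends, so that an
outerplanar graph is a graph without interleaved edges for some circular order of its vertices.
Adding the edges between circularly consecutive vertices creates no crossing and yields a
biconnected graph. Conversely, in a biconnected graph without crossings consecutive vertices `u`,
`v` are adjacent: deleting the farthest neighbour of `v` would otherwise separate `v` from `u`. A
Hamiltonian cycle of such a graph is itself a biconnected graph without crossings, hence it contains
the boundary cycle of the drawing and equals it; its order is the circular order up to rotation and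
reflection.

Under an ordered protocol a player's share is not influenced by later players, so best responses
chosen one after the other form an equilibrium. In any equilibrium a player can walk to an earlier
player, or to the root, and follow that path for free, so she pays at most the cost of this walk.
Let every player `i` walk to her predecessor on the tour through a spanning forest of an optimal
outcome. Deleting an edge `x y` of the forest leaves disjoint components of `x` and `y`, which
cannot interleave along the tour, so that at most once in each direction does the tour pass,
between consecutive players, from one to the other. Hence every edge is charged at most twice.
-/

namespace Multicast

section CircularOrder

variable {V α : Type*} [CircularOrder α]

theorem sbtw_or_sbtw_of_ne {a b c : α} (hab : a ≠ b) (hbc : b ≠ c) (hca : c ≠ a) :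
    sbtw a b c ∨ sbtw c b a := by
  rw [sbtw_iff_not_btw, sbtw_iff_not_btw, ← not_and_or]
  rintro ⟨hcba, habc⟩
  rcases habc.antisymm hcba with h | h | h
  exacts [hab h, hbc h, hca h]

theorem sbtw_of_sbtw_of_sbtw {a b x y : α} (hx : sbtw a x b) (hy : sbtw b y a) : sbtw x b y :=
  (sbtw_trans_right hy hx.cyclic_right).cyclic_right

/-- `G` has no two crossing edges when its vertices are placed in the circular order given by `r`:
the ends of an edge do not lie strictly on the two sides of another edge. -/
def NonCrossing (G : SimpleGraph V) (r : V → α) : Prop :=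
  ∀ ⦃a b x y : V⦄, G.Adj a b → G.Adj x y → sbtw (r a) (r x) (r b) → ¬ sbtw (r b) (r y) (r a)

theorem NonCrossing.mono {G H : SimpleGraph V} {r : V → α} (hH : NonCrossing H r) (hGH : G ≤ H) :
    NonCrossing G r :=
  fun _ _ _ _ hab hxy => hH (hGH hab) (hGH hxy)

/-- Positions on a tour are natural numbers, read as points of a cycle. -/
instance : CircularOrder ℕ := LinearOrder.toCircularOrder ℕ

end CircularOrder

section Drawing

/-- Twice the signed area of the triangle `a b c`; it is positive iff the triangle is
counterclockwise. -/
def orient (a b c : ℂ) : ℝ :=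
  (b.re - a.re) * (c.im - a.im) - (b.im - a.im) * (c.re - a.re)

theorem orient_rotate (a b c : ℂ) : orient b c a = orient a b c := by
  simp only [orient]; ring

theorem orient_swap (a b c : ℂ) : orient a c b = -orient a b c := by
  simp only [orient]; ring

theorem orient_left_self (a b : ℂ) : orient a b a = 0 := by
  simp only [orient]; ring

theorem orient_right_self (a b : ℂ) : orient a b b = 0 := by
  simp only [orient]; ring

theorem orient_convex_combination (a b x y : ℂ) {s t : ℝ} (hst : s + t = 1) :
    orient a b (s • x + t • y) = s * orient a b x + t * orient a b y := by
  simp only [orient, Complex.add_re, Complex.add_im, Complex.smul_re, Complex.smul_im, smul_eq_mul]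
  linear_combination ((b.re - a.re) * a.im - (b.im - a.im) * a.re) * hst

theorem disjoint_segment_of_orient_mul_pos {a b x y : ℂ}
    (h : 0 < orient a b x * orient a b y) : Disjoint (segment ℝ a b) (segment ℝ x y) := by
  rw [Set.disjoint_left]
  rintro _ ⟨s, t, -, -, hst, rfl⟩ ⟨s', t', hs', ht', hst', heq⟩
  have hzero : s' * orient a b x + t' * orient a b y = 0 := by
    rw [← orient_convex_combination a b x y hst', heq, orient_convex_combination a b a b hst,
      orient_left_self, orient_right_self, mul_zero, mul_zero, add_zero]
  rcases pos_and_pos_or_neg_and_neg_of_mul_pos h with ⟨hx, hy⟩ | ⟨hx, hy⟩ <;>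
    rcases hs'.eq_or_lt with hs' | hs' <;> nlinarith

theorem not_disjoint_segment_of_orient_pos {a x b y : ℂ} (haxb : 0 < orient a x b)
    (hxby : 0 < orient x b y) (hbya : 0 < orient b y a) (hyax : 0 < orient y a x) :
    ¬ Disjoint (segment ℝ a b) (segment ℝ x y) := by
  have harea : orient a x b + orient b y a = orient x b y + orient y a x := by
    simp only [orient]; ring
  have hpos : 0 < orient a x b + orient b y a := add_pos haxb hbya
  rw [Set.not_disjoint_iff]
  -- The diagonals divide each other in the ratios of the triangles that they cut off.
  refine ⟨(orient x b y / (orient a x b + orient b y a)) • a +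
      (orient y a x / (orient a x b + orient b y a)) • b,
    ⟨_, _, by positivity, by positivity, ?_, rfl⟩,
    ⟨orient b y a / (orient a x b + orient b y a), orient a x b / (orient a x b + orient b y a),
      by positivity, by positivity, ?_, ?_⟩⟩
  · rw [← add_div, ← harea, div_self hpos.ne']
  · rw [← add_div, add_comm (orient b y a), div_self hpos.ne']
  · apply Complex.ext
    all_goals
      simp only [Complex.add_re, Complex.add_im, Complex.smul_re, Complex.smul_im, smul_eq_mul]
      field_simp
      simp only [orient]
      ring

theorem sin_add_sin_sub_sin_add (x y : ℝ) :
    Real.sin (2 * x) + Real.sin (2 * y) - Real.sin (2 * x + 2 * y) =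
      4 * Real.sin x * Real.sin y * Real.sin (x + y) := by
  simp only [Real.sin_add, Real.sin_two_mul, Real.cos_two_mul]
  linear_combination (-4 * Real.sin y * Real.cos y) * Real.sin_sq_add_cos_sq x -
    (4 * Real.sin x * Real.cos x) * Real.sin_sq_add_cos_sq y

theorem orient_circle (a b c : Circle) :
    orient a b c = 4 * Real.sin ((Complex.arg b - Complex.arg a) / 2) *
      Real.sin ((Complex.arg c - Complex.arg b) / 2) *
      Real.sin ((Complex.arg c - Complex.arg a) / 2) := by
  have re (z : Circle) : (z : ℂ).re = Real.cos (Complex.arg z) := by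
    rw [Complex.cos_arg z.coe_ne_zero, Circle.norm_coe, div_one]
  have im (z : Circle) : (z : ℂ).im = Real.sin (Complex.arg z) := by
    rw [Complex.sin_arg, Circle.norm_coe, div_one]
  have key := sin_add_sin_sub_sin_add ((Complex.arg b - Complex.arg a) / 2)
    ((Complex.arg c - Complex.arg b) / 2)
  ring_nf at key ⊢
  rw [← key, orient]
  simp only [re, im, Real.sin_add, Real.sin_neg, Real.cos_neg, sub_eq_add_neg]
  ring

theorem orient_pos_of_arg_lt {a b c : Circle} (hab : Complex.arg a < Complex.arg b)
    (hbc : Complex.arg b < Complex.arg c) : 0 < orient a b c := by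
  have ha := Complex.neg_pi_lt_arg a
  have hc := Complex.arg_le_pi c
  have sin_pos {x y : ℝ} (hx : -Real.pi < x) (hxy : x < y) (hy : y ≤ Real.pi) :
      0 < Real.sin ((y - x) / 2) :=
    Real.sin_pos_of_pos_of_lt_pi (by linarith) (by linarith)
  rw [orient_circle]
  have h₁ := sin_pos ha hab (hbc.le.trans hc)
  have h₂ := sin_pos (ha.trans hab) hbc hc
  have h₃ := sin_pos ha (hab.trans hbc) hc
  positivity

variable {V : Type*}

theorem sbtw_iff_orient_pos {n : ℕ} {p : V → Circle} {r : V → Fin n}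
    (hr : ∀ u v, r u < r v ↔ Complex.arg (p u) < Complex.arg (p v)) (hp : Function.Injective p)
    {a b c : V} : sbtw (r a) (r b) (r c) ↔ 0 < orient (p a) (p b) (p c) := by
  have orient_pos_of_sbtw {a b c : V} (h : sbtw (r a) (r b) (r c)) :
      0 < orient (p a) (p b) (p c) := by
    rcases Fin.sbtw_iff.1 h with ⟨h, h'⟩ | ⟨h, h'⟩ | ⟨h, h'⟩ <;> rw [hr] at h h'
    · exact orient_pos_of_arg_lt h h'
    · rw [← orient_rotate]
      exact orient_pos_of_arg_lt h h'
    · rw [orient_rotate]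
      exact orient_pos_of_arg_lt h h'
  refine ⟨orient_pos_of_sbtw, fun h => ?_⟩
  have hr' : Function.Injective r := by
    intro u v huv
    refine hp (Circle.injective_arg (le_antisymm ?_ ?_)) <;>
      rw [← not_lt, ← hr, huv] <;> exact lt_irrefl _
  have hab : a ≠ b := by rintro rfl; rw [← orient_rotate, orient_left_self] at h; exact h.false
  have hbc : b ≠ c := by rintro rfl; rw [orient_right_self] at h; exact h.false
  have hca : c ≠ a := by rintro rfl; rw [orient_left_self] at h; exact h.false
  refine (sbtw_or_sbtw_of_ne (hr'.ne hab) (hr'.ne hbc) (hr'.ne hca)).resolve_right fun hcba => ?_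
  have := orient_pos_of_sbtw hcba
  rw [orient_rotate, orient_swap] at this
  linarith

/-- Drawing the vertices at the points `p` and the edges as straight segments, no two edges without
a common end meet. -/
def IsPlaneDrawing (G : SimpleGraph V) (p : V → ℂ) : Prop :=
  ∀ a b x y : V, G.Adj a b → G.Adj x y → a ≠ x → a ≠ y → b ≠ x → b ≠ y →
    Disjoint (segment ℝ (p a) (p b)) (segment ℝ (p x) (p y))

theorem isPlaneDrawing_iff_nonCrossing {α : Type*} [CircularOrder α] {G : SimpleGraph V}
    {p : V → ℂ} {r : V → α} (hr : Function.Injective r)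
    (h : ∀ a b c, sbtw (r a) (r b) (r c) ↔ 0 < orient (p a) (p b) (p c)) :
    IsPlaneDrawing G p ↔ NonCrossing G r := by
  constructor
  · intro hG a b x y hab hxy hx hy
    have ne {u v w : V} (huvw : sbtw (r u) (r v) (r w)) : u ≠ v ∧ w ≠ v :=
      ⟨by rintro rfl; exact sbtw_irrefl_left huvw, by rintro rfl; exact sbtw_irrefl_right huvw⟩
    exact not_disjoint_segment_of_orient_pos ((h _ _ _).1 hx)
      ((h _ _ _).1 (sbtw_of_sbtw_of_sbtw hx hy)) ((h _ _ _).1 hy)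
      ((h _ _ _).1 (sbtw_of_sbtw_of_sbtw hy hx))
      (hG a b x y hab hxy (ne hx).1 (ne hy).2 (ne hx).2 (ne hy).1)
  · intro hG a b x y hab hxy hax hay hbx hby
    have side (z : V) (haz : a ≠ z) (hbz : b ≠ z) :
        sbtw (r a) (r z) (r b) ∧ orient (p a) (p b) (p z) < 0 ∨
          sbtw (r b) (r z) (r a) ∧ 0 < orient (p a) (p b) (p z) := by
      refine (sbtw_or_sbtw_of_ne (hr.ne haz) (hr.ne hbz.symm) (hr.ne hab.ne.symm)).imp
        (fun hz => ⟨hz, ?_⟩) fun hz => ⟨hz, ?_⟩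
      · rw [orient_swap]
        exact neg_neg_of_pos ((h _ _ _).1 hz)
      · rw [← h]
        exact hz.cyclic_right
    apply disjoint_segment_of_orient_mul_pos
    rcases side x hax hbx with ⟨hx, hx'⟩ | ⟨hx, hx'⟩ <;>
      rcases side y hay hby with ⟨hy, hy'⟩ | ⟨hy, hy'⟩
    · exact mul_pos_of_neg_of_neg hx' hy'
    · exact (hG hab hxy hx hy).elim
    · exact (hG hab hxy.symm hy hx).elim
    · exact mul_pos hx' hy'

theorem isOuterplanar_iff_exists_nonCrossing [Fintype V] {n : ℕ} (hn : Fintype.card V = n)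
    {G : SimpleGraph V} : IsOuterplanar G ↔ ∃ σ : V ≃ Fin n, NonCrossing G σ := by
  constructor
  · rintro ⟨p, hp, hG⟩
    let _ : LinearOrder V := LinearOrder.lift' _ (Circle.injective_arg.comp hp)
    let e : V ≃o Fin n := (Fintype.orderIsoFinOfCardEq V hn).symm
    have he (u v : V) : e u < e v ↔ Complex.arg (p u) < Complex.arg (p v) := e.lt_iff_lt
    exact ⟨e.toEquiv, (isPlaneDrawing_iff_nonCrossing e.injective fun _ _ _ =>
      sbtw_iff_orient_pos he hp).1 hG⟩
  · rintro ⟨σ, hσ⟩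
    have harg (v : V) : Complex.arg (Circle.exp ((σ v : ℝ) / n)) = (σ v : ℝ) / n := by
      have hlt : ((σ v : ℝ) / n) < 1 := by
        rw [div_lt_one (by exact_mod_cast (σ v).pos)]
        exact_mod_cast (σ v).isLt
      exact Circle.arg_exp (by linarith [Real.pi_pos, show (0 : ℝ) ≤ (σ v : ℝ) / n by positivity])
        (by linarith [Real.pi_gt_three])
    have hlt (u v : V) : σ u < σ v ↔ Complex.arg (Circle.exp ((σ u : ℝ) / n)) <
        Complex.arg (Circle.exp ((σ v : ℝ) / n)) := by
      have hn0 : (0 : ℝ) < n := by exact_mod_cast (σ u).pos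
      rw [harg, harg, div_lt_div_iff_of_pos_right hn0, Nat.cast_lt, Fin.val_fin_lt]
    have hinj : Function.Injective fun v => Circle.exp ((σ v : ℝ) / n) := by
      intro u v huv
      apply σ.injective
      apply le_antisymm <;> rw [← not_lt, hlt] <;> simp only [huv, lt_irrefl, not_false_eq_true]
    exact ⟨_, hinj, (isPlaneDrawing_iff_nonCrossing σ.injective fun _ _ _ =>
      sbtw_iff_orient_pos hlt hinj).2 hσ⟩

end Drawing

section Consecutive

variable {V α : Type*} [CircularOrder α] {H : SimpleGraph V} {r : V → α}

theorem NonCrossing.adj_of_forall_not_sbtw [Fintype V] (hr : Function.Injective r)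
    (hH : NonCrossing H r) (hbi : IsBiconnected H) {u v : V} (huv : u ≠ v)
    (hgap : ∀ x, ¬ sbtw (r u) (r x) (r v)) : H.Adj v u := by
  by_contra hvu
  let beyond (x y : V) : Prop := sbtw (r v) (r y) (r x)
  have : IsTrans V beyond := ⟨fun _ _ _ hxy hyz => hyz.trans_right hxy⟩
  have : Std.Irrefl beyond := ⟨fun _ => sbtw_irrefl_right⟩
  have : Nontrivial V := ⟨u, v, huv⟩
  obtain ⟨m, hvm, hfar⟩ := (Finite.wellFounded_of_trans_of_irrefl beyond).has_min
    (H.neighborSet v) (hbi.connected.preconnected.exists_adj_of_nontrivial v)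
  have hmu : m ≠ u := by rintro rfl; exact hvu hvm
  have hu : sbtw (r v) (r m) (r u) :=
    (sbtw_or_sbtw_of_ne (hr.ne hvm.ne) (hr.ne hmu) (hr.ne huv)).resolve_right (hgap m)
  -- As `m` is the farthest neighbour of `v`, a path from `v` to `u` avoiding `m` crosses `v m`.
  obtain ⟨q⟩ := (hbi.connected_delete m).preconnected ⟨v, hvm.ne⟩ ⟨u, hmu.symm⟩
  obtain ⟨d, -, hd, hd'⟩ := q.exists_boundary_dart {z | ¬ sbtw (r v) (r m) (r z)}
    sbtw_irrefl_left_right (not_not.2 hu)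
  have hadj : H.Adj d.fst d.snd := d.adj
  have hdm : (d.fst : V) ≠ m := d.fst.2
  replace hd' : sbtw (r v) (r m) (r d.snd) := not_not.1 hd'
  rcases eq_or_ne (d.fst : V) v with hdv | hdv
  · exact hfar _ (hdv ▸ hadj) hd'
  · have hfst : sbtw (r d.fst) (r m) (r v) :=
      (sbtw_or_sbtw_of_ne (hr.ne hvm.ne) (hr.ne hdm.symm) (hr.ne hdv)).resolve_left hd
    exact hH hvm hadj hfst.cyclic_right hd'.cyclic_left

end Consecutive

section CyclicGraph

variable {V : Type*} {k : ℕ}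

theorem not_sbtw_add_one (i j : Fin (k + 3)) : ¬ sbtw i j (i + 1) := by
  have hval := Fin.val_add_eq_ite i 1
  rw [Fin.val_one] at hval
  simp only [Fin.sbtw_iff, Fin.lt_def]
  split_ifs at hval <;> omega

theorem sbtw_add_left_iff (c : Fin (k + 3)) {i j l : Fin (k + 3)} :
    sbtw (c + i) (c + j) (c + l) ↔ sbtw i j l := by
  simp only [Fin.sbtw_iff, Fin.lt_def, Fin.val_add_eq_ite]
  split_ifs <;> omega

theorem sbtw_sub_left_iff (c : Fin (k + 3)) {i j l : Fin (k + 3)} :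
    sbtw (c - i) (c - j) (c - l) ↔ sbtw l j i := by
  have val_sub (i : Fin (k + 3)) : (c - i).val =
      if i.val ≤ c.val then c.val - i.val else c.val + (k + 3) - i.val := by
    split_ifs with h
    · exact Fin.sub_val_of_le h
    · rw [Fin.coe_sub_iff_lt.2 (not_le.1 h)]
      omega
  simp only [Fin.sbtw_iff, Fin.lt_def, val_sub]
  split_ifs <;> omega

theorem NonCrossing.add_left {H : SimpleGraph V} {r : V → Fin (k + 3)} (hH : NonCrossing H r)
    (c : Fin (k + 3)) : NonCrossing H fun v => c + r v := by
  simpa only [NonCrossing, sbtw_add_left_iff] using hH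

theorem NonCrossing.sub_left {H : SimpleGraph V} {r : V → Fin (k + 3)} (hH : NonCrossing H r)
    (c : Fin (k + 3)) : NonCrossing H fun v => c - r v := by
  intro a b x y hab hxy hx hy
  rw [sbtw_sub_left_iff] at hx hy
  exact hH hab.symm hxy hx hy

/-- The cycle through all vertices in the cyclic order given by the numbering `σ`. -/
def cyclicGraph (σ : V ≃ Fin (k + 3)) : SimpleGraph V :=
  (SimpleGraph.cycleGraph (k + 3)).comap σ

theorem cyclicGraph_adj {σ : V ≃ Fin (k + 3)} {u v : V} :
    (cyclicGraph σ).Adj u v ↔ σ u = σ v + 1 ∨ σ v = σ u + 1 := by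
  simp only [cyclicGraph, SimpleGraph.comap_adj, SimpleGraph.cycleGraph_adj, sub_eq_iff_eq_add,
    add_comm (1 : Fin (k + 3))]

theorem not_sbtw_or_not_sbtw_of_cyclicGraph_adj {σ : V ≃ Fin (k + 3)} {u v : V}
    (huv : (cyclicGraph σ).Adj u v) :
    (∀ x, ¬ sbtw (σ u) x (σ v)) ∨ ∀ x, ¬ sbtw (σ v) x (σ u) := by
  rcases cyclicGraph_adj.1 huv with h | h
  · exact .inr fun x => h ▸ not_sbtw_add_one _ x
  · exact .inl fun x => h ▸ not_sbtw_add_one _ x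

theorem NonCrossing.sup_cyclicGraph {G : SimpleGraph V} {σ : V ≃ Fin (k + 3)}
    (hG : NonCrossing G σ) : NonCrossing (G ⊔ cyclicGraph σ) σ := by
  rintro a b x y (hab | hab) (hxy | hxy) hx hy
  · exact hG hab hxy hx hy
  · exact (not_sbtw_or_not_sbtw_of_cyclicGraph_adj hxy).elim (· _ (sbtw_of_sbtw_of_sbtw hx hy))
      (· _ (sbtw_of_sbtw_of_sbtw hy hx))
  all_goals exact (not_sbtw_or_not_sbtw_of_cyclicGraph_adj hab).elim (· _ hx) (· _ hy)

theorem NonCrossing.cyclicGraph_le [Fintype V] {H : SimpleGraph V} {σ : V ≃ Fin (k + 3)}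
    (hH : NonCrossing H σ) (hbi : IsBiconnected H) : cyclicGraph σ ≤ H := by
  intro u v huv
  rcases not_sbtw_or_not_sbtw_of_cyclicGraph_adj huv with h | h
  · exact (hH.adj_of_forall_not_sbtw σ.injective hbi huv.ne fun x => h (σ x)).symm
  · exact hH.adj_of_forall_not_sbtw σ.injective hbi huv.ne.symm fun x => h (σ x)

theorem IsBiconnected.mono [Fintype V] {G H : SimpleGraph V} (hG : IsBiconnected G)
    (hGH : G ≤ H) : IsBiconnected H where
  three_le_card := hG.three_le_card
  connected := hG.connected.mono hGH
  connected_delete v := (hG.connected_delete v).mono fun _ _ hab => hGH hab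

theorem connected_induce_compl_cyclicGraph (σ : V ≃ Fin (k + 3)) (v : V) :
    ((cyclicGraph σ).induce {v}ᶜ).Connected := by
  let f (i : Fin (k + 2)) : V := σ.symm (σ v + i.succ)
  have hf (i : Fin (k + 2)) : f i ∈ ({v}ᶜ : Set V) := by
    rw [Set.mem_compl_singleton_iff, Ne, Equiv.symm_apply_eq, add_eq_left]
    exact i.succ_ne_zero
  have hadj {i j : Fin (k + 2)} (hij : i.val + 1 = j.val) : σ (f j) = σ (f i) + 1 := by
    have : j.succ = i.succ + 1 :=
      Fin.ext (by rw [Fin.val_add_one_of_lt' (by simp; omega), Fin.val_succ, Fin.val_succ, hij])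
    simp only [f, Equiv.apply_symm_apply, this, add_assoc]
  let F : SimpleGraph.pathGraph (k + 2) →g (cyclicGraph σ).induce {v}ᶜ :=
    { toFun := fun i => ⟨f i, hf i⟩
      map_rel' := fun hij =>
        cyclicGraph_adj.2 ((SimpleGraph.pathGraph_adj.1 hij).symm.imp hadj hadj) }
  refine (SimpleGraph.pathGraph_connected (k + 1)).map F fun ⟨w, hw⟩ => ?_
  obtain ⟨i, hi⟩ := Fin.exists_succ_eq.2 (sub_ne_zero.2 (σ.injective.ne hw))
  exact ⟨i, Subtype.ext ((Equiv.symm_apply_eq σ).2 (by rw [hi, add_sub_cancel]))⟩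

theorem isBiconnected_cyclicGraph [Fintype V] (σ : V ≃ Fin (k + 3)) :
    IsBiconnected (cyclicGraph σ) where
  three_le_card := by rw [Fintype.card_congr σ, Fintype.card_fin]; omega
  connected := by
    rw [cyclicGraph, (SimpleGraph.Iso.comap σ _).connected_iff]
    exact SimpleGraph.cycleGraph_connected
  connected_delete := connected_induce_compl_cyclicGraph σ

theorem eq_add_or_eq_sub_of_cycleGraph_adj {g : Fin (k + 3) → Fin (k + 3)}
    (hg : Function.Injective g)
    (hadj : ∀ i, (SimpleGraph.cycleGraph (k + 3)).Adj (g i) (g (i + 1))) :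
    ∃ c, (∀ i, g i = c + i) ∨ ∀ i, g i = c - i := by
  have step (i : Fin (k + 3)) : g (i + 1) = g i + 1 ∨ g (i + 1) = g i - 1 := by
    rcases SimpleGraph.cycleGraph_adj.1 (hadj i) with h | h
    · exact .inr (eq_sub_of_add_eq' (sub_eq_iff_eq_add.1 h).symm)
    · exact .inl (sub_eq_iff_eq_add'.1 h)
  have no_return (i : Fin (k + 3)) : g (i + 1 + 1) ≠ g i := by
    refine hg.ne ?_
    rw [add_assoc, Ne, add_eq_left]
    exact Fin.ext_iff.not.2 (by simp [Fin.val_add_eq_ite])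
  have cyclic_induction {P : Fin (k + 3) → Prop} (h0 : P 0) (hs : ∀ i, P i → P (i + 1)) :
      ∀ i, P i :=
    Fin.induction h0 fun i hi => Fin.coeSucc_eq_succ ▸ hs _ hi
  refine ⟨g 0, (step 0).imp (fun h0 => ?_) fun h0 => ?_⟩
  · have up : ∀ i, g (i + 1) = g i + 1 := cyclic_induction h0 fun i hi =>
      (step _).resolve_right fun h => no_return i (by rw [h, hi, add_sub_cancel_right])
    exact cyclic_induction (add_zero _).symm fun i hi => by rw [up, hi, add_assoc]
  · have down : ∀ i, g (i + 1) = g i - 1 := cyclic_induction h0 fun i hi =>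
      (step _).resolve_left fun h => no_return i (by rw [h, hi, sub_add_cancel])
    exact cyclic_induction (sub_zero _).symm fun i hi => by rw [down, hi, sub_sub]

theorem NonCrossing.of_cyclicGraph_le {H : SimpleGraph V} {σ τ : V ≃ Fin (k + 3)}
    (hH : NonCrossing H σ) (hτ : cyclicGraph τ ≤ H) :
    cyclicGraph τ = cyclicGraph σ ∧ NonCrossing H τ := by
  have : Fintype V := Fintype.ofEquiv _ τ.symm
  have hστ : cyclicGraph σ ≤ cyclicGraph τ :=
    (hH.mono hτ).cyclicGraph_le (isBiconnected_cyclicGraph τ)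
  obtain ⟨c, h⟩ := eq_add_or_eq_sub_of_cycleGraph_adj (g := τ ∘ σ.symm)
    (τ.injective.comp σ.symm.injective) fun i =>
      hστ (cyclicGraph_adj.2 (.inr (by simp only [Equiv.apply_symm_apply])))
  rcases h with h | h
  all_goals
    replace h (v : V) := (congrArg τ (σ.symm_apply_apply v).symm).trans (h (σ v))
    have hτ : ⇑τ = fun v => _ := funext h
    rw [hτ]
  · refine ⟨?_, hH.add_left c⟩
    ext u v
    simp only [cyclicGraph, SimpleGraph.comap_adj, SimpleGraph.cycleGraph_adj, h,
      add_sub_add_left_eq_sub]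
  · refine ⟨?_, hH.sub_left c⟩
    ext u v
    simp only [cyclicGraph, SimpleGraph.comap_adj, SimpleGraph.cycleGraph_adj, h,
      sub_sub_sub_cancel_left]
    exact or_comm

end CyclicGraph

section Tour

variable {V : Type*} [DecidableEq V] {k : ℕ} {H : SimpleGraph V} {t u v : V} {p : H.Walk t t}

theorem tourPosition_root (p : H.Walk t t) : tourPosition p t = 0 := by
  rw [tourPosition, ← p.cons_tail_support, List.idxOf_cons_self]

theorem getVert_tourPosition (hv : v ∈ p.support) : p.getVert (tourPosition p v) = v :=
  p.getVert_support_idxOf hv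

theorem tourPosition_lt_length (hp : ¬ p.Nil) (hv : v ∈ p.support) :
    tourPosition p v < p.length := by
  have hle : tourPosition p v < p.length + 1 :=
    p.length_support ▸ List.idxOf_lt_length_of_mem hv
  refine (Nat.lt_succ_iff.1 hle).lt_of_ne fun hlast => hp ?_
  have hvt : v = t := by rw [← getVert_tourPosition hv, hlast, p.getVert_length]
  rw [← SimpleGraph.Walk.length_eq_zero_iff, ← hlast, hvt, tourPosition_root]

theorem tourPosition_getVert (hp : p.IsCycle) {i : ℕ} (hi : i < p.length) :
    tourPosition p (p.getVert i) = i := by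
  have hmem := p.getVert_mem_support i
  exact hp.getVert_injOn' (Nat.le_sub_one_of_lt (tourPosition_lt_length hp.not_nil hmem))
    (Nat.le_sub_one_of_lt hi) (getVert_tourPosition hmem)

theorem tourPosition_injective (hp : p.IsHamiltonianCycle) :
    Function.Injective (tourPosition p) :=
  Function.LeftInverse.injective (g := p.getVert) fun v => getVert_tourPosition (hp.mem_support v)

theorem exists_equiv_val_eq_tourPosition [Fintype V] (hV : Fintype.card V = k + 3)
    (hp : p.IsHamiltonianCycle) : ∃ τ : V ≃ Fin (k + 3), ∀ v, (τ v).val = tourPosition p v := by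
  have hlt (v : V) : tourPosition p v < k + 3 :=
    (tourPosition_lt_length hp.isCycle.not_nil (hp.mem_support v)).trans_eq
      (hp.length_eq.trans hV)
  have hinj : Function.Injective fun v => (⟨tourPosition p v, hlt v⟩ : Fin (k + 3)) :=
    fun _ _ huv => tourPosition_injective hp (Fin.ext_iff.1 huv)
  exact ⟨Equiv.ofBijective _ ((Fintype.bijective_iff_injective_and_card _).2
    ⟨hinj, hV.trans (Fintype.card_fin _).symm⟩), fun _ => rfl⟩

theorem mem_edges_iff_cyclicGraph_adj (hp : p.IsHamiltonianCycle) {τ : V ≃ Fin (k + 3)}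
    (hτ : ∀ v, (τ v).val = tourPosition p v) :
    s(u, v) ∈ p.edges ↔ (cyclicGraph τ).Adj u v := by
  have : Fintype V := Fintype.ofEquiv _ τ.symm
  have hlen : p.length = k + 3 := by
    rw [hp.length_eq, Fintype.card_congr τ, Fintype.card_fin]
  have hnum {i : ℕ} (hi : i ≤ p.length) : τ (p.getVert i) = Fin.ofNat (k + 3) i := by
    rw [Fin.ext_iff, hτ, Fin.val_ofNat]
    rcases hi.lt_or_eq with hi | rfl
    · rw [tourPosition_getVert hp.isCycle hi, Nat.mod_eq_of_lt (hlen ▸ hi)]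
    · rw [p.getVert_length, tourPosition_root, hlen, Nat.mod_self]
  have hsucc {i : ℕ} (hi : i < p.length) : τ (p.getVert (i + 1)) = τ (p.getVert i) + 1 := by
    rw [hnum hi, hnum hi.le]
    exact Fin.ext (by simp [Fin.val_add])
  have hedge {u v : V} (h : τ v = τ u + 1) : s(u, v) ∈ p.edges := by
    have hu := tourPosition_lt_length hp.isCycle.not_nil (hp.mem_support u)
    refine p.mk_mem_edges_iff_exists.2 ⟨_, hu, ?_⟩
    have hv : p.getVert (tourPosition p u + 1) = v := by
      apply τ.injective
      rw [hsucc hu, getVert_tourPosition (hp.mem_support u), h]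
    rw [hv, getVert_tourPosition (hp.mem_support u)]
  rw [cyclicGraph_adj]
  constructor
  · rw [p.mk_mem_edges_iff_exists]
    rintro ⟨i, hi, h⟩
    rcases Sym2.eq_iff.1 h with ⟨rfl, rfl⟩ | ⟨rfl, rfl⟩
    · exact .inr (hsucc hi)
    · exact .inl (hsucc hi)
  · rintro (h | h)
    · exact Sym2.eq_swap ▸ hedge h
    · exact hedge h

theorem exists_isHamiltonianCycle_of_cyclicGraph_le {σ : V ≃ Fin (k + 3)}
    (hσ : cyclicGraph σ ≤ H) (t : V) : ∃ p : H.Walk t t, p.IsHamiltonianCycle := by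
  have : Fintype V := Fintype.ofEquiv _ σ.symm
  have : Nontrivial V := σ.nontrivial
  refine SimpleGraph.IsHamiltonian.exists_isHamiltonianCycle (fun _ => ?_) t
  let f : SimpleGraph.cycleGraph (k + 3) →g H :=
    (SimpleGraph.Hom.ofLE hσ).comp (SimpleGraph.Iso.comap σ _).symm.toHom
  have hf : Function.Bijective f := σ.symm.bijective
  refine ⟨_, (SimpleGraph.cycleGraph.cycle k).map f, SimpleGraph.Walk.IsHamiltonianCycle.map hf ?_⟩
  rw [SimpleGraph.Walk.isHamiltonianCycle_iff_isCycle_and_length_eq]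
  exact ⟨SimpleGraph.cycleGraph.isCycle_cycle, by simp⟩

theorem NonCrossing.exists_nonCrossing_val_eq_tourPosition {σ : V ≃ Fin (k + 3)}
    (hH : NonCrossing H σ) (hp : p.IsHamiltonianCycle) :
    ∃ τ : V ≃ Fin (k + 3), (∀ v, (τ v).val = tourPosition p v) ∧
      cyclicGraph τ = cyclicGraph σ ∧ NonCrossing H τ := by
  have : Fintype V := Fintype.ofEquiv _ σ.symm
  obtain ⟨τ, hτ⟩ := exists_equiv_val_eq_tourPosition
    ((Fintype.card_congr σ).trans (Fintype.card_fin _)) hp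
  exact ⟨τ, hτ, hH.of_cyclicGraph_le fun _ _ huv =>
    p.adj_of_mem_edges ((mem_edges_iff_cyclicGraph_adj hp hτ).2 huv)⟩

theorem NonCrossing.mem_edges_iff_mem_edgeSet {σ : V ≃ Fin (k + 3)} (hH : NonCrossing H σ)
    (hp : p.IsHamiltonianCycle) (e : Sym2 V) : e ∈ p.edges ↔ e ∈ (cyclicGraph σ).edgeSet := by
  obtain ⟨τ, hτ, heq, -⟩ := hH.exists_nonCrossing_val_eq_tourPosition hp
  cases e with
  | h u v => rw [mem_edges_iff_cyclicGraph_adj hp hτ, heq, SimpleGraph.mem_edgeSet]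

theorem NonCrossing.nonCrossing_tourPosition {σ : V ≃ Fin (k + 3)} (hH : NonCrossing H σ)
    (hp : p.IsHamiltonianCycle) : NonCrossing H (tourPosition p) := by
  obtain ⟨τ, hτ, -, hτH⟩ := hH.exists_nonCrossing_val_eq_tourPosition hp
  have : NonCrossing H fun v => (τ v).val := hτH
  simpa only [hτ] using this

end Tour

section Separation

variable {V α : Type*}

theorem exists_adj_of_reachable {K : SimpleGraph V} {P : V → Prop} {a b : V}
    (hab : K.Reachable a b) (ha : P a) (hb : ¬ P b) :
    ∃ c d, K.Reachable a c ∧ K.Adj c d ∧ P c ∧ ¬ P d := by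
  classical
  obtain ⟨q⟩ := hab
  obtain ⟨e, he, hfst, hsnd⟩ := q.exists_boundary_dart {z | P z} ha hb
  exact ⟨e.fst, e.snd, ⟨q.takeUntil _ (q.dart_fst_mem_support_of_mem_darts he)⟩, e.adj, hfst, hsnd⟩

theorem NonCrossing.sbtw_of_reachable [CircularOrder α] {K : SimpleGraph V} {r : V → α}
    (hr : Function.Injective r) (hK : NonCrossing K r) {u v c d : V} (huv : K.Adj u v)
    (hcd : K.Reachable c d) (huc : ¬ K.Reachable u c) (hc : sbtw (r u) (r c) (r v)) :
    sbtw (r u) (r d) (r v) := by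
  by_contra hd
  obtain ⟨x, y, hcx, hxy, hx, hy⟩ := exists_adj_of_reachable (P := fun z => sbtw (r u) (r z) (r v))
    hcd hc hd
  have hcy : K.Reachable c y := hcx.trans hxy.reachable
  have huy : u ≠ y := by rintro rfl; exact huc hcy.symm
  have hvy : v ≠ y := by rintro rfl; exact huc (huv.reachable.trans hcy.symm)
  exact hK huv hxy hx
    ((sbtw_or_sbtw_of_ne (hr.ne huy) (hr.ne hvy.symm) (hr.ne huv.ne.symm)).resolve_left hy)

theorem NonCrossing.reachable_of_interleave [CircularOrder α] {K : SimpleGraph V} {r : V → α}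
    (hr : Function.Injective r) (hK : NonCrossing K r) {a b x y : V} (hab : K.Reachable a b)
    (hxy : K.Reachable x y) (hx : sbtw (r a) (r x) (r b)) (hy : sbtw (r b) (r y) (r a)) :
    K.Reachable a x := by
  by_contra hax
  obtain ⟨c, d, hxc, hcd, hc, hd⟩ := exists_adj_of_reachable (P := fun z => sbtw (r a) (r z) (r b))
    hxy hx (sbtw_asymm hy)
  have hxd : K.Reachable x d := hxc.trans hcd.reachable
  have had : a ≠ d := by rintro rfl; exact hax hxd.symm
  have hbd : b ≠ d := by rintro rfl; exact hax (hab.trans hxd.symm)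
  have hne : r b ≠ r a := by rintro h; rw [h] at hy; exact sbtw_irrefl_left_right hy
  have hd' : sbtw (r b) (r d) (r a) :=
    (sbtw_or_sbtw_of_ne (hr.ne had) (hr.ne hbd.symm) hne).resolve_left hd
  have hda : ¬ K.Reachable d a := fun h => hax (hxd.trans h).symm
  have hdbc : sbtw (r d) (r b) (r c) :=
    hK.sbtw_of_reachable hr hcd.symm hab hda (sbtw_of_sbtw_of_sbtw hd' hc)
  exact sbtw_asymm hdbc (sbtw_of_sbtw_of_sbtw hc hd')

theorem reachable_deleteEdges_or {T : SimpleGraph V} {x y z : V} (hxz : T.Reachable x z) :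
    (T.deleteEdges {s(x, y)}).Reachable x z ∨ (T.deleteEdges {s(x, y)}).Reachable y z := by
  by_contra hz
  obtain ⟨a, b, -, hab, ha, hb⟩ := exists_adj_of_reachable
    (P := fun z => (T.deleteEdges {s(x, y)}).Reachable x z ∨
      (T.deleteEdges {s(x, y)}).Reachable y z) hxz (.inl .rfl) hz
  by_cases he : s(a, b) = s(x, y)
  · rcases Sym2.eq_iff.1 he with ⟨-, rfl⟩ | ⟨-, rfl⟩
    · exact hb (.inr .rfl)
    · exact hb (.inl .rfl)
  · have hab' : (T.deleteEdges {s(x, y)}).Reachable a b :=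
      (SimpleGraph.deleteEdges_adj.2 ⟨hab, he⟩ : (T.deleteEdges _).Adj a b).reachable
    exact hb (ha.imp (·.trans hab') (·.trans hab'))

theorem not_reachable_deleteEdges {T : SimpleGraph V} (hT : T.IsAcyclic) {u v x y : V}
    (q : T.Path u v) (he : s(x, y) ∈ q.1.edges) : ¬ (T.deleteEdges {s(x, y)}).Reachable u v := by
  classical
  rw [SimpleGraph.reachable_deleteEdges_iff_exists_walk]
  rintro ⟨w, hw⟩
  rw [(hT.subsingleton_path u v).elim q w.toPath] at he
  exact hw (w.edges_toPath_subset_edges he)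

theorem reachable_deleteEdges_and_or {T : SimpleGraph V} (hT : T.IsAcyclic) {u v x y : V}
    (q : T.Path u v) (he : s(x, y) ∈ q.1.edges) :
    (T.deleteEdges {s(x, y)}).Reachable x u ∧ (T.deleteEdges {s(x, y)}).Reachable y v ∨
      (T.deleteEdges {s(x, y)}).Reachable y u ∧ (T.deleteEdges {s(x, y)}).Reachable x v := by
  classical
  have hx := q.1.fst_mem_support_of_mem_edges he
  have hsep := not_reachable_deleteEdges hT q he
  have hu := reachable_deleteEdges_or (y := y) (q.1.takeUntil x hx).reachable.symm
  have hv := reachable_deleteEdges_or (y := y) (q.1.dropUntil x hx).reachable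
  rcases hu with hu | hu <;> rcases hv with hv | hv
  · exact (hsep (hu.symm.trans hv)).elim
  · exact .inl ⟨hu, hv⟩
  · exact .inr ⟨hu, hv⟩
  · exact (hsep (hu.symm.trans hv)).elim

theorem NonCrossing.eq_of_reachable [CircularOrder α] {K : SimpleGraph V} {r : V → α}
    (hr : Function.Injective r) (hK : NonCrossing K r) {a b a' b' : V} (ha : K.Reachable a a')
    (hb : K.Reachable b b') (hab : ¬ K.Reachable a b) (hgap : ¬ sbtw (r a) (r b') (r b))
    (hgap' : ¬ sbtw (r a') (r b) (r b')) : b = b' := by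
  by_contra hbb
  have ne {u v : V} (hu : K.Reachable a u) (hv : K.Reachable b v) : r u ≠ r v :=
    hr.ne (by rintro rfl; exact hab (hu.trans hv.symm))
  have hba : sbtw (r b) (r b') (r a) :=
    (sbtw_or_sbtw_of_ne (ne .rfl hb) (hr.ne (Ne.symm hbb)) (ne .rfl .rfl).symm).resolve_left hgap
  have hba' : sbtw (r b') (r b) (r a') :=
    (sbtw_or_sbtw_of_ne (ne ha .rfl) (hr.ne hbb) (ne ha hb).symm).resolve_left hgap'
  exact hab (ha.trans
    (hK.reachable_of_interleave hr hb ha.symm hba'.cyclic_left hba.cyclic_left).symm)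

theorem NonCrossing.card_filter_mem_edges_le_two [CircularOrder α] [DecidableEq V] {ι : Type*}
    [Fintype ι] {T : SimpleGraph V} {r : V → α} (hr : Function.Injective r) (hT : NonCrossing T r)
    (hac : T.IsAcyclic) {s pred : ι → V} (hs : Function.Injective s)
    (hgap : ∀ i j, ¬ sbtw (r (pred i)) (r (s j)) (r (s i))) (q : ∀ i, T.Path (pred i) (s i))
    (e : Sym2 V) : (Finset.univ.filter fun i => e ∈ (q i).1.edges).card ≤ 2 := by
  classical
  induction e with | h x y =>
  have card_le_one (z w : V) : (Finset.univ.filter fun i => s(x, y) ∈ (q i).1.edges ∧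
      (T.deleteEdges {s(x, y)}).Reachable z (pred i) ∧
      (T.deleteEdges {s(x, y)}).Reachable w (s i)).card ≤ 1 := by
    rw [Finset.card_le_one]
    intro i hi j hj
    obtain ⟨he, hzi, hwi⟩ := (Finset.mem_filter.1 hi).2
    obtain ⟨-, hzj, hwj⟩ := (Finset.mem_filter.1 hj).2
    exact hs ((hT.mono (T.deleteEdges_le _)).eq_of_reachable hr (hzi.symm.trans hzj)
      (hwi.symm.trans hwj) (not_reachable_deleteEdges hac (q i) he) (hgap i j) (hgap j i))
  refine (Finset.card_le_card fun i hi => ?_).trans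
    ((Finset.card_union_le _ _).trans (add_le_add (card_le_one x y) (card_le_one y x)))
  have he := (Finset.mem_filter.1 hi).2
  rw [← Finset.filter_or, Finset.mem_filter, ← and_or_left]
  exact ⟨Finset.mem_univ i, he, reachable_deleteEdges_and_or hac (q i) he⟩

theorem NonCrossing.sum_sum_edges_le [CircularOrder α] [DecidableEq V] {ι : Type*}
    [Fintype ι] {T : SimpleGraph V} {r : V → α} (hr : Function.Injective r) (hT : NonCrossing T r)
    (hac : T.IsAcyclic) {s pred : ι → V} (hs : Function.Injective s)
    (hgap : ∀ i j, ¬ sbtw (r (pred i)) (r (s j)) (r (s i))) (q : ∀ i, T.Path (pred i) (s i))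
    (c : Sym2 V → ℝ≥0) {E : Finset (Sym2 V)} (hE : T.edgeSet ⊆ E) :
    ∑ i, ∑ e ∈ pathEdges (q i), c e ≤ 2 * ∑ e ∈ E, c e := by
  have hqE (i : ι) : E.filter (· ∈ (q i).1.edges) = pathEdges (q i) := by
    ext e
    rw [pathEdges, List.mem_toFinset, Finset.mem_filter, and_iff_right_iff_imp]
    exact fun he => hE ((q i).1.edges_subset_edgeSet he)
  calc ∑ i, ∑ e ∈ pathEdges (q i), c e
      = ∑ e ∈ E, ∑ i with e ∈ (q i).1.edges, c e := by
        simp only [← hqE, Finset.sum_filter]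
        exact Finset.sum_comm
    _ ≤ ∑ e ∈ E, 2 * c e := Finset.sum_le_sum fun e _ => by
        rw [Finset.sum_const, nsmul_eq_mul]
        gcongr
        exact_mod_cast hT.card_filter_mem_edges_le_two hr hac hs hgap q e
    _ = 2 * ∑ e ∈ E, c e := (Finset.mul_sum ..).symm

end Separation

section OrderedProtocol

variable {V : Type*} [DecidableEq V] {G : SimpleGraph V} {t : V} {S : Finset V}
  {c : Sym2 V → ℝ≥0} {π : V → ℕ} {P P' : Outcome G t S}

theorem mem_users {e : Sym2 V} {j : V} :
    j ∈ users P e ↔ ∃ h : j ∈ S, e ∈ pathEdges (P ⟨j, h⟩) := by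
  simp [users]

theorem orderedProtocol_le (e : Sym2 V) (i : V) (R : Finset V) :
    orderedProtocol c π e i R ≤ c e := by
  unfold orderedProtocol
  split_ifs
  · exact le_rfl
  · exact zero_le

theorem orderedProtocol_eq_zero_of_lt {e : Sym2 V} {i j : V} {R : Finset V} (hj : j ∈ R)
    (hji : π j < π i) : orderedProtocol c π e i R = 0 :=
  if_neg fun h => (h.2 j hj).not_gt hji

theorem exists_mem_orderedProtocol_eq (c : Sym2 V → ℝ≥0) (π : V → ℕ) (e : Sym2 V)
    {R : Finset V} (hR : R.Nonempty) : ∃ i ∈ R, orderedProtocol c π e i R = c e := by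
  obtain ⟨i, hi, hmin⟩ := R.exists_min_image π hR
  exact ⟨i, hi, if_pos ⟨hi, hmin⟩⟩

/-- The edges on the paths of an outcome. -/
def usedEdges (P : Outcome G t S) : Finset (Sym2 V) :=
  Finset.univ.biUnion fun i : S => pathEdges (P i)

theorem mem_usedEdges {e : Sym2 V} : e ∈ usedEdges P ↔ ∃ i, e ∈ pathEdges (P i) := by
  simp [usedEdges]

theorem outcomeCost_le_sum_playerCost (c : Sym2 V → ℝ≥0) (π : V → ℕ) (P : Outcome G t S) :
    outcomeCost c P ≤ ∑ i, playerCost (orderedProtocol c π) P i := by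
  have hpaid {e : Sym2 V} (he : e ∈ usedEdges P) :
      c e ≤ ∑ i with e ∈ pathEdges (P i), orderedProtocol c π e i (users P e) := by
    obtain ⟨i, hi⟩ := mem_usedEdges.1 he
    obtain ⟨j, hj, hpay⟩ :=
      exists_mem_orderedProtocol_eq c π e ⟨i.1, mem_users.2 ⟨i.2, hi⟩⟩
    obtain ⟨hjS, hej⟩ := mem_users.1 hj
    rw [← hpay]
    exact Finset.single_le_sum (f := fun i : S => orderedProtocol c π e i (users P e))
      (fun _ _ => zero_le) (Finset.mem_filter.2 ⟨Finset.mem_univ (⟨j, hjS⟩ : S), hej⟩)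
  calc outcomeCost c P
      ≤ ∑ e ∈ usedEdges P, ∑ i with e ∈ pathEdges (P i),
          orderedProtocol c π e i (users P e) := Finset.sum_le_sum fun _ => hpaid
    _ = ∑ i, playerCost (orderedProtocol c π) P i := by
      refine (Finset.sum_comm' fun i e => ?_).symm
      simp only [Finset.mem_univ, true_and, Finset.mem_filter]
      exact (and_iff_left_of_imp fun he => mem_usedEdges.2 ⟨i, he⟩).symm

theorem playerCost_congr {i : S} (h : ∀ j : S, π j ≤ π i → P j = P' j) :
    playerCost (orderedProtocol c π) P i = playerCost (orderedProtocol c π) P' i := by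
  have first_user {P P' : Outcome G t S} (h : ∀ j : S, π j ≤ π i → P j = P' j) {e : Sym2 V}
      (he : i.1 ∈ users P e ∧ ∀ j ∈ users P e, π i ≤ π j) :
      i.1 ∈ users P' e ∧ ∀ j ∈ users P' e, π i ≤ π j := by
    obtain ⟨hi, hei⟩ := mem_users.1 he.1
    refine ⟨mem_users.2 ⟨hi, h i le_rfl ▸ hei⟩, fun j hj => le_of_not_gt fun hji => ?_⟩
    obtain ⟨hjS, hej⟩ := mem_users.1 hj
    exact (he.2 j (mem_users.2 ⟨hjS, (h ⟨j, hjS⟩ hji.le).symm ▸ hej⟩)).not_gt hji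
  unfold playerCost
  rw [h i le_rfl]
  exact Finset.sum_congr rfl fun e _ =>
    if_congr ⟨first_user h, first_user fun j hj => (h j hj).symm⟩ rfl rfl

/-- Player `i` cannot lower her cost share in the outcome `P` by changing her own path; a Nash
equilibrium is an outcome in which this holds for every player. -/
def IsBestResponse (ξ : Protocol V) (P : Outcome G t S) (i : S) : Prop :=
  ∀ Q : G.Path (i : V) t, playerCost ξ P i ≤ playerCost ξ (Function.update P i Q) i

theorem IsBestResponse.congr {i : S} (hP : IsBestResponse (orderedProtocol c π) P i)
    (h : ∀ j : S, π j ≤ π i → P j = P' j) : IsBestResponse (orderedProtocol c π) P' i := by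
  intro Q
  rw [← playerCost_congr h]
  refine (hP Q).trans_eq (playerCost_congr fun j hj => ?_)
  rcases eq_or_ne j i with rfl | hji
  · rw [Function.update_self, Function.update_self]
  · rw [Function.update_of_ne hji, Function.update_of_ne hji, h j hj]

theorem exists_isBestResponse_update [Finite V] (ξ : Protocol V) (P : Outcome G t S) (i : S) :
    ∃ Q, IsBestResponse ξ (Function.update P i Q) i := by
  have := Fintype.ofFinite V
  classical
  have : Nonempty (G.Path (i : V) t) := ⟨P i⟩
  obtain ⟨Q, hQ⟩ := Finite.exists_min fun Q => playerCost ξ (Function.update P i Q) i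
  refine ⟨Q, fun Q' => ?_⟩
  rw [Function.update_idem]
  exact hQ Q'

theorem exists_forall_lt_isBestResponse [Finite V] (hG : G.Connected)
    (c : Sym2 V → ℝ≥0) (hπ : Function.Injective π) (m : ℕ) :
    ∃ P : Outcome G t S, ∀ i : S, π i < m → IsBestResponse (orderedProtocol c π) P i := by
  induction m with
  | zero => exact ⟨fun i => (hG.preconnected i t).some.toPath, fun i hi => absurd hi (by simp)⟩
  | succ m ih =>
    obtain ⟨P, hP⟩ := ih
    by_cases hm : ∃ i : S, π i = m
    · obtain ⟨i, rfl⟩ := hm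
      obtain ⟨Q, hQ⟩ := exists_isBestResponse_update (orderedProtocol c π) P i
      refine ⟨Function.update P i Q, fun j hj => ?_⟩
      rcases (Nat.le_of_lt_succ hj).lt_or_eq with hj | hj
      · refine (hP j hj).congr fun l hl => (Function.update_of_ne ?_ _ _).symm
        rintro rfl
        exact hl.not_gt hj
      · rwa [Subtype.ext (hπ hj)]
    · exact ⟨P, fun i hi => hP i ((Nat.le_of_lt_succ hi).lt_of_ne fun h => hm ⟨i, h⟩)⟩

theorem exists_isNash [Finite V] (hG : G.Connected) (c : Sym2 V → ℝ≥0)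
    (hπ : Function.Injective π) : ∃ P : Outcome G t S, IsNash (orderedProtocol c π) P := by
  obtain ⟨P, hP⟩ := exists_forall_lt_isBestResponse hG c hπ (S.sup π + 1)
  exact ⟨P, fun i => hP i (Nat.lt_succ_of_le (Finset.le_sup (f := π) i.2))⟩

theorem playerCost_update_toPath_le {i : S} {j : V} (q : G.Walk i j) (w : G.Walk j t)
    (hw : ∀ (Q : G.Path (i : V) t), ∀ e ∈ w.edges,
      orderedProtocol c π e i (users (Function.update P i Q) e) = 0) :
    playerCost (orderedProtocol c π) (Function.update P i (q.append w).toPath) i ≤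
      ∑ e ∈ q.edges.toFinset, c e := by
  unfold playerCost
  rw [Function.update_self]
  refine (Finset.sum_le_sum_of_ne_zero fun e he hne => ?_).trans
    (Finset.sum_le_sum fun e _ => orderedProtocol_le e i _)
  have he' := (q.append w).edges_toPath_subset_edges (List.mem_toFinset.1 he)
  rw [SimpleGraph.Walk.edges_append, List.mem_append] at he'
  exact List.mem_toFinset.2 (he'.resolve_right fun h => hne (hw _ e h))

theorem IsNash.playerCost_le (hP : IsNash (orderedProtocol c π) P) {i : S} {j : V}
    (hj : j ∈ insert t S) (hji : π j < π i) (q : G.Walk i j) :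
    playerCost (orderedProtocol c π) P i ≤ ∑ e ∈ q.edges.toFinset, c e := by
  rcases Finset.mem_insert.1 hj with rfl | hjS
  · exact (hP i _).trans (playerCost_update_toPath_le q .nil (by simp))
  · refine (hP i _).trans (playerCost_update_toPath_le q (P ⟨j, hjS⟩).1 fun Q e he =>
      orderedProtocol_eq_zero_of_lt (mem_users.2 ⟨hjS, ?_⟩) hji)
    have hne : (⟨j, hjS⟩ : S) ≠ i := by rintro rfl; exact lt_irrefl _ hji
    rw [Function.update_of_ne hne]
    exact List.mem_toFinset.2 he

end OrderedProtocol

section PriceOfAnarchy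

variable {V : Type*} [DecidableEq V] {G : SimpleGraph V} {t : V} {S : Finset V}
  {c : Sym2 V → ℝ≥0} {π : V → ℕ} {P : Outcome G t S}

theorem exists_mem_insert_lt_forall_not_sbtw (S : Finset V) {t v : V} (ht : π t < π v) :
    ∃ j ∈ insert t S, π j < π v ∧ ∀ l ∈ S, ¬ sbtw (π j) (π l) (π v) := by
  obtain ⟨j, hj, hmax⟩ := ((insert t S).filter fun j => π j < π v).exists_max_image π
    ⟨t, Finset.mem_filter.2 ⟨Finset.mem_insert_self t S, ht⟩⟩
  obtain ⟨hjS, hjv⟩ := Finset.mem_filter.1 hj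
  refine ⟨j, hjS, hjv, fun l hl h => ?_⟩
  have hlv : π l < π v → π l ≤ π j := fun hlv =>
    hmax l (Finset.mem_filter.2 ⟨Finset.mem_insert_of_mem hl, hlv⟩)
  have hcases : π j < π l ∧ π l < π v ∨ π l < π v ∧ π v < π j ∨ π v < π j ∧ π j < π l := h
  lia

theorem exists_isAcyclic_le_forall_reachable (P : Outcome G t S) :
    ∃ T ≤ G, T.IsAcyclic ∧ T.edgeSet ⊆ usedEdges P ∧ ∀ i : S, T.Reachable i t := by
  let F : SimpleGraph V := SimpleGraph.fromEdgeSet (usedEdges P)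
  have hFG : F ≤ G := by
    intro u v huv
    obtain ⟨i, hi⟩ := mem_usedEdges.1 ((SimpleGraph.fromEdgeSet_adj _).1 huv).1
    exact (P i).1.adj_of_mem_edges (List.mem_toFinset.1 hi)
  have hF (i : S) : F.Reachable i t :=
    ⟨(P i).1.transfer F fun e he => by
      rw [SimpleGraph.edgeSet_fromEdgeSet]
      exact ⟨mem_usedEdges.2 ⟨i, List.mem_toFinset.2 he⟩,
        G.not_isDiag_of_mem_edgeSet ((P i).1.edges_subset_edgeSet he)⟩⟩
  obtain ⟨T, hTF, hT, hreach⟩ := F.exists_isAcyclic_reachable_eq_le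
  refine ⟨T, hTF.trans hFG, hT, fun e he => ?_, fun i => hreach ▸ hF i⟩
  have he' := SimpleGraph.edgeSet_mono hTF he
  rw [SimpleGraph.edgeSet_fromEdgeSet] at he'
  exact he'.1

theorem IsNash.outcomeCost_le (hG : NonCrossing G π) (hπ : Function.Injective π)
    (ht : ∀ i ∈ S, π t < π i) (hP : IsNash (orderedProtocol c π) P) (P' : Outcome G t S) :
    outcomeCost c P ≤ 2 * outcomeCost c P' := by
  obtain ⟨T, hTG, hT, hTP', hreach⟩ := exists_isAcyclic_le_forall_reachable P'
  choose pred hmem hlt hgap using fun i : S => exists_mem_insert_lt_forall_not_sbtw S (ht i i.2)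
  have hpred (i : S) : T.Reachable (pred i) i := by
    refine .trans ?_ (hreach i).symm
    rcases Finset.mem_insert.1 (hmem i) with h | h
    · rw [h]
    · exact hreach ⟨_, h⟩
  let q (i : S) : T.Path (pred i) i := (hpred i).some.toPath
  have hshare (i : S) : playerCost (orderedProtocol c π) P i ≤ ∑ e ∈ pathEdges (q i), c e := by
    have h := hP.playerCost_le (hmem i) (hlt i) ((q i).1.mapLe hTG).reverse
    rwa [SimpleGraph.Walk.edges_reverse, List.toFinset_reverse,
      SimpleGraph.Walk.edges_mapLe_eq_edges] at h
  calc outcomeCost c P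
      ≤ ∑ i, playerCost (orderedProtocol c π) P i := outcomeCost_le_sum_playerCost c π P
    _ ≤ ∑ i, ∑ e ∈ pathEdges (q i), c e := Finset.sum_le_sum fun i _ => hshare i
    _ ≤ 2 * outcomeCost c P' := (hG.mono hTG).sum_sum_edges_le hπ hT Subtype.val_injective
        (fun i j => hgap i j j.2) q c hTP'

theorem priceOfAnarchy_le_two (hG : NonCrossing G π) (hπ : Function.Injective π)
    (ht : ∀ v, π t ≤ π v) : priceOfAnarchy G t c (orderedProtocol c π) ≤ 2 := by
  refine iSup_le fun S => iSup_le fun hS => iSup_le fun P => iSup_le fun hP => ?_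
  refine ENNReal.div_le_of_le_mul ?_
  rw [optCost, ENNReal.mul_iInf_of_ne two_ne_zero ENNReal.ofNat_ne_top]
  have ht' : ∀ i ∈ S, π t < π i := fun i hi =>
    (ht i).lt_of_ne (hπ.ne fun h => hS (h ▸ hi))
  exact le_iInf fun P' => mod_cast hP.outcomeCost_le hG hπ ht' P'

end PriceOfAnarchy

end Multicast

open Multicast in
theorem mainTheorem4_general {V : Type*} [Fintype V] [DecidableEq V] (hV : 3 ≤ Fintype.card V)
    (G : SimpleGraph V) (hconn : G.Connected) (hG : IsOuterplanar G)
    (c : Sym2 V → ℝ≥0) (t : V) :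
    (∃ H : SimpleGraph V, G ≤ H ∧ IsBiconnected H ∧ IsOuterplanar H) ∧
    ∀ H : SimpleGraph V, G ≤ H → IsBiconnected H → IsOuterplanar H →
      (∃ p : H.Walk t t, p.IsHamiltonianCycle) ∧
      (∀ p q : H.Walk t t, p.IsHamiltonianCycle → q.IsHamiltonianCycle →
        ∀ e : Sym2 V, e ∈ p.edges ↔ e ∈ q.edges) ∧
      ∀ p : H.Walk t t, p.IsHamiltonianCycle →
        (∀ S : Finset V, ∃ P : Outcome G t S, IsNash (tourProtocol c p) P) ∧
        priceOfAnarchy G t c (tourProtocol c p) ≤ 2 := by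
  obtain ⟨k, hk⟩ := Nat.exists_eq_add_of_le' hV
  obtain ⟨σ, hσ⟩ := (isOuterplanar_iff_exists_nonCrossing hk).1 hG
  refine ⟨⟨G ⊔ cyclicGraph σ, le_sup_left,
    (isBiconnected_cyclicGraph σ).mono le_sup_right,
    (isOuterplanar_iff_exists_nonCrossing hk).2 ⟨σ, hσ.sup_cyclicGraph⟩⟩,
    fun H hGH hbi hH => ?_⟩
  obtain ⟨τ, hτ⟩ := (isOuterplanar_iff_exists_nonCrossing hk).1 hH
  refine ⟨exists_isHamiltonianCycle_of_cyclicGraph_le (hτ.cyclicGraph_le hbi) t,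
    fun p q hp hq e => ?_, fun p hp => ?_⟩
  · rw [hτ.mem_edges_iff_mem_edgeSet hp, hτ.mem_edges_iff_mem_edgeSet hq]
  · have hinj := tourPosition_injective hp
    refine ⟨fun S => exists_isNash hconn c hinj, priceOfAnarchy_le_two
      ((hτ.nonCrossing_tourPosition hp).mono hGH) hinj fun v => ?_⟩
    rw [tourPosition_root]
    exact Nat.zero_le _

theorem mainTheorem4 {V : Type*} [Fintype V] [DecidableEq V] (hV : 3 ≤ Fintype.card V)
    (G : SimpleGraph V) (hconn : G.Connected) (hG : Multicast.IsOuterplanar G)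
    (c : Sym2 V → ℝ≥0) (t : V) :
    (∃ H : SimpleGraph V, G ≤ H ∧ Multicast.IsBiconnected H ∧ Multicast.IsOuterplanar H) ∧
    ∀ H : SimpleGraph V, G ≤ H → Multicast.IsBiconnected H → Multicast.IsOuterplanar H →
      (∃ p : H.Walk t t, p.IsHamiltonianCycle) ∧
      (∀ p q : H.Walk t t, p.IsHamiltonianCycle → q.IsHamiltonianCycle →
        ∀ e : Sym2 V, e ∈ p.edges ↔ e ∈ q.edges) ∧
      ∀ p : H.Walk t t, p.IsHamiltonianCycle →
        (∀ S : Finset V, t ∉ S →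
          ∃ P : Multicast.Outcome G t S, Multicast.IsNash (Multicast.tourProtocol c p) P) ∧
        Multicast.priceOfAnarchy G t c (Multicast.tourProtocol c p) ≤ 8 :=
  (mainTheorem4_general hV G hconn hG c t).imp_right fun htour H hGH hbi hH =>
    (htour H hGH hbi hH).imp_right <| .imp_right fun hNash p hp =>
      (hNash p hp).imp (fun hex S _ => hex S) (·.trans (by norm_num))
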